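/- Let $\tau:\mathbb{N}_{\ge 1}\to\mathbb{Z}$ be Ramanujan's tau function, defined by the identity of formal power series $\sum_{n\ge 1}\tau(n)q^n = q\prod_{n\ge 1}(1-q^n)^{24}$ in $\mathbb{Z}[[q]]$. Let $l\ge 2$ be a prime number and put $\Delta(l)=\tau(l)^2-4\,l^{11}$. Then for every prime number $p$ coprime to $\Delta(l)$, where $\left(\frac{\cdot}{p}\right)$ denotes the Legendre symbol (for $a$ coprime to $p$, $\left(\frac{a}{p}\right)=1$ if $a$ is a square modulo $p$ and $-1$ otherwise): 1. if $\left(\frac{\Delta(l)}{p}\right)=1$, then $\tau(l^p)\equiv\tau(l)\pmod p$; 2. if $\left(\frac{\Delta(l)}{p}\right)=-1$, then $\tau(l^p)\equiv 0\pmod p$. -/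

import Mathlib

section RamanujanTau

open PowerSeries
open scoped PowerSeries.WithPiTopology

/-- The infinite product `∏_{n ≥ 1} (1 - q ^ n) ^ 24` converges in `ℤ⟦q⟧`, for the usual topology
on formal power series (coefficientwise convergence, `ℤ` being discrete). -/
theorem multipliable_one_sub_X_pow_pow_24 :
    Multipliable (fun n : ℕ => (1 - (X : ℤ⟦X⟧) ^ (n + 1)) ^ 24) :=
  (PowerSeries.WithPiTopology.multipliable_one_sub_X_pow ℤ).pow 24

/-- The formal power series `q ∏_{n ≥ 1} (1 - q ^ n) ^ 24` with integer coefficients. -/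
noncomputable def ramanujanSeries : ℤ⟦X⟧ :=
  X * ∏' n : ℕ, (1 - (X : ℤ⟦X⟧) ^ (n + 1)) ^ 24

/-- Ramanujan's tau function: `∑_{n ≥ 1} τ(n) q ^ n = q ∏_{n ≥ 1} (1 - q ^ n) ^ 24`. -/
noncomputable def ramanujanTau (n : ℕ) : ℤ :=
  PowerSeries.coeff n ramanujanSeries

/-- `Δ(l) = τ(l)² - 4 l¹¹`, the discriminant of `X² - τ(l) X + l¹¹`. -/
noncomputable def ramanujanDisc (l : ℕ) : ℤ :=
  ramanujanTau l ^ 2 - 4 * (l : ℤ) ^ 11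

end RamanujanTau

/-!
The modular discriminant `Δ = ∑ τ(n) q ^ n` is an eigenform of the Hecke operator `T_l`, because the
space of level one cusp forms of weight `12` is one-dimensional. Hence `n ↦ τ(l ^ n)` is the Lucas
sequence with parameters `τ(l)` and `l ^ 11`, and `2 ^ n * τ(l ^ n)` is the coefficient of `√d` in
`(τ(l) + √d) ^ (n + 1)`, where `d = Δ(l)`. Modulo an odd prime `p` the Frobenius map of `ℤ[√d]`
sends `√d` to `(d / p) √d`, so that `2 τ(l ^ p) ≡ (1 + (d / p)) τ(l)`.

The prime `p = 2` is never coprime to `Δ(l)`, because `τ(l)` is even: `τ(2)` since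
`Δ = q (∏ (1 - q ^ n) ^ 12) ^ 2`, and `τ(l)` for odd `l` since `E₄ ^ 3 - E₆ ^ 2 = 1728 Δ` shows that
it has the parity of the number of divisors of `l`.
-/

section LucasSequence

theorem sqrtd_pow_of_odd (d : ℤ) {n : ℕ} (hn : Odd n) :
    (.sqrtd : ℤ√d) ^ n = (d ^ (n / 2) : ℤ) * .sqrtd := by
  conv_lhs => rw [← Nat.two_mul_div_two_add_one_of_odd hn, pow_succ, pow_mul, sq, Zsqrtd.dmuld]
  norm_cast

theorem pow_half_modEq_legendreSym (p : ℕ) [Fact p.Prime] (d : ℤ) :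
    d ^ (p / 2) ≡ legendreSym p d [ZMOD p] := by
  rw [← ZMod.intCast_eq_intCast_iff, legendreSym.eq_pow, Int.cast_pow]

theorem zsqrtd_pow_prime_modEq {d : ℤ} {p : ℕ} [Fact p.Prime] (hp2 : p ≠ 2) (x : ℤ√d) :
    (x ^ p).re ≡ x.re [ZMOD p] ∧ (x ^ p).im ≡ legendreSym p d * x.im [ZMOD p] := by
  have hp : p.Prime := Fact.out
  obtain ⟨r, hr⟩ := exists_add_pow_prime_eq hp (x.re : ℤ√d) (.sqrtd * x.im)
  set s : ℤ√d := x.re * (.sqrtd * x.im) * r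
  have hpow : x ^ p = ⟨x.re ^ p, d ^ (p / 2) * x.im ^ p⟩ + (p : ℤ) * s := by
    rw [← Zsqrtd.decompose, mul_pow, sqrtd_pow_of_odd d (hp.odd_of_ne_two hp2)] at hr
    rw [hr, Zsqrtd.decompose]
    push_cast
    ring
  rw [hpow, Zsqrtd.re_add, Zsqrtd.re_smul, Zsqrtd.im_add, Zsqrtd.im_smul]
  exact ⟨Int.modEq_add_fac_self.trans (.pow_prime_eq_self hp _),
    Int.modEq_add_fac_self.trans
      ((pow_half_modEq_legendreSym p d).mul (.pow_prime_eq_self hp _))⟩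

variable {t Q : ℤ} {u : ℕ → ℤ}

theorem im_add_sqrtd_pow_succ (h0 : u 0 = 1) (h1 : u 1 = t)
    (hu : ∀ n, u (n + 2) = t * u (n + 1) - Q * u n) (n : ℕ) :
    ((t + .sqrtd : ℤ√(t ^ 2 - 4 * Q)) ^ (n + 1)).im = 2 ^ n * u n := by
  set x : ℤ√(t ^ 2 - 4 * Q) := t + .sqrtd with hx
  have hsq : x ^ 2 = (2 * t : ℤ) * x - (4 * Q : ℤ) := by
    have := Zsqrtd.dmuld (d := t ^ 2 - 4 * Q)
    push_cast at this ⊢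
    linear_combination this
  induction n using Nat.twoStepInduction with
  | zero => simp [hx, h0]
  | one =>
    rw [one_add_one_eq_two, hsq, Zsqrtd.im_sub, Zsqrtd.im_smul]
    simp [hx, h1]
  | more n ih₁ ih₂ =>
    have hpow : x ^ (n + 2 + 1) = (2 * t : ℤ) * x ^ (n + 1 + 1) - (4 * Q : ℤ) * x ^ (n + 1) := by
      linear_combination x ^ (n + 1) * hsq
    rw [hpow, Zsqrtd.im_sub, Zsqrtd.im_smul, Zsqrtd.im_smul, ih₁, ih₂, hu]
    ring

theorem two_mul_lucas_prime_modEq {p : ℕ} [Fact p.Prime] (hp2 : p ≠ 2) (h0 : u 0 = 1)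
    (h1 : u 1 = t) (hu : ∀ n, u (n + 2) = t * u (n + 1) - Q * u n) :
    2 * u p ≡ (1 + legendreSym p (t ^ 2 - 4 * Q)) * t [ZMOD p] := by
  set x : ℤ√(t ^ 2 - 4 * Q) := t + .sqrtd
  obtain ⟨hre, him⟩ := zsqrtd_pow_prime_modEq hp2 x
  calc 2 * u p ≡ 2 ^ p * u p [ZMOD p] := (Int.ModEq.pow_prime_eq_self Fact.out 2).symm.mul_right _
    _ = (x ^ p).re * x.im + (x ^ p).im * x.re := by
      rw [← im_add_sqrtd_pow_succ h0 h1 hu, pow_succ x, Zsqrtd.im_mul]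
    _ ≡ x.re * x.im + legendreSym p (t ^ 2 - 4 * Q) * x.im * x.re [ZMOD p] :=
      (hre.mul_right _).add (him.mul_right _)
    _ = (1 + legendreSym p (t ^ 2 - 4 * Q)) * t := by simp [x]; ring

end LucasSequence

section TaylorCoefficients

open Filter Topology

theorem tendstoLocallyUniformlyOn_pow {X M ι : Type*} [TopologicalSpace X] [SeminormedRing M]
    {F : ι → X → M} {f : X → M} {l : Filter ι} {s : Set X}
    (h : TendstoLocallyUniformlyOn F f l s) (hf : ContinuousOn f s) (k : ℕ) :
    TendstoLocallyUniformlyOn (fun i x => F i x ^ k) (fun x => f x ^ k) l s := by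
  induction k with
  | zero =>
    simp only [pow_zero]
    exact (tendsto_const_nhds.tendstoUniformlyOn_const s).tendstoLocallyUniformlyOn
  | succ k ih =>
    simp only [pow_succ]
    exact ih.mul₀ h (hf.pow k) hf

theorem tendsto_iteratedDeriv_of_tendstoLocallyUniformlyOn {ι E : Type*} [NormedAddCommGroup E]
    [NormedSpace ℂ E] [CompleteSpace E] {l : Filter ι} {U : Set ℂ} {F : ι → ℂ → E} {f : ℂ → E}
    (hU : IsOpen U) (h : TendstoLocallyUniformlyOn F f l U)
    (hF : ∀ i, DifferentiableOn ℂ (F i) U) {z : ℂ} (hz : z ∈ U) (n : ℕ) :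
    Tendsto (fun i => iteratedDeriv n (F i) z) l (𝓝 (iteratedDeriv n f z)) := by
  induction n generalizing F f with
  | zero => simpa only [iteratedDeriv_zero] using h.tendsto_at hz
  | succ n ih =>
    simp only [iteratedDeriv_succ']
    exact ih (h.deriv (.of_forall hF) hU) fun i => (hF i).deriv hU

theorem iteratedDeriv_polynomial_eval {𝕜 : Type*} [NontriviallyNormedField 𝕜] (P : Polynomial 𝕜)
    (n : ℕ) :
    iteratedDeriv n (fun z => P.eval z) = fun z => (Polynomial.derivative^[n] P).eval z := by
  induction n with
  | zero => simp
  | succ n ih =>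
    ext z
    rw [iteratedDeriv_succ, ih, Polynomial.deriv, Function.iterate_succ_apply']

theorem iteratedDeriv_polynomial_eval_zero {𝕜 : Type*} [NontriviallyNormedField 𝕜]
    (P : Polynomial 𝕜) (n : ℕ) :
    iteratedDeriv n (fun z => P.eval z) 0 = n.factorial * P.coeff n := by
  simp only [iteratedDeriv_polynomial_eval, ← Polynomial.coeff_zero_eq_eval_zero,
    Polynomial.coeff_iterate_derivative, zero_add, Nat.descFactorial_self, nsmul_eq_mul]

theorem iteratedDeriv_zero_of_eventually_coeff_eq {ι : Type*} {l : Filter ι} [l.NeBot] {U : Set ℂ}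
    {P : ι → Polynomial ℂ} {f : ℂ → ℂ} (hU : IsOpen U) (h0 : 0 ∈ U)
    (h : TendstoLocallyUniformlyOn (fun i z => (P i).eval z) f l U) {n : ℕ} {c : ℂ}
    (hc : ∀ᶠ i in l, (P i).coeff n = c) : iteratedDeriv n f 0 = n.factorial * c := by
  refine tendsto_nhds_unique (tendsto_iteratedDeriv_of_tendstoLocallyUniformlyOn hU h
    (fun i => (P i).differentiable.differentiableOn) h0 n) (tendsto_const_nhds.congr' ?_)
  filter_upwards [hc] with i hi
  rw [iteratedDeriv_polynomial_eval_zero, hi]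

end TaylorCoefficients

section DiscriminantQExpansion

open Filter Topology PowerSeries

/-- The polynomial `q ∏_{i ∈ s} (1 - q ^ (i + 1)) ^ 24`, a partial product of both the power series
`ramanujanSeries` and the `q`-expansion of the modular discriminant. -/
noncomputable def discriminantPartialProd (s : Finset ℕ) : Polynomial ℤ :=
  Polynomial.X * ∏ i ∈ s, (1 - Polynomial.X ^ (i + 1)) ^ 24

theorem coe_discriminantPartialProd (s : Finset ℕ) :
    (discriminantPartialProd s : ℤ⟦X⟧) = X * ∏ i ∈ s, (1 - X ^ (i + 1)) ^ 24 := by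
  rw [← Polynomial.coeToPowerSeries.ringHom_apply, discriminantPartialProd, map_mul, map_prod]
  simp

open scoped PowerSeries.WithPiTopology in
theorem eventually_coeff_discriminantPartialProd (n : ℕ) :
    ∀ᶠ s in atTop, (discriminantPartialProd s).coeff n = ramanujanTau n := by
  have hlim : Tendsto (fun s => (discriminantPartialProd s : ℤ⟦X⟧)) atTop (𝓝 ramanujanSeries) := by
    simp only [coe_discriminantPartialProd]
    exact multipliable_one_sub_X_pow_pow_24.hasProd.const_mul X
  have hcoeff := (PowerSeries.WithPiTopology.tendsto_iff_coeff_tendsto ℤ _ _ _).mp hlim n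
  simpa only [Polynomial.coeff_coe, nhds_discrete, tendsto_pure, ramanujanTau] using hcoeff

theorem tendstoLocallyUniformlyOn_discriminantPartialProd :
    TendstoLocallyUniformlyOn
      (fun s z => ((discriminantPartialProd s).map (Int.castRingHom ℂ)).eval z)
      (UpperHalfPlane.cuspFunction 1 ModularForm.discriminant) atTop (Metric.ball 0 1) := by
  have hcont := ModularForm.differentiableOn_tprod_one_sub_pow.continuousOn
  have hprod := ModularForm.multipliableLocallyUniformlyOn_one_sub_pow.hasProdLocallyUniformlyOn
  rw [hasProdLocallyUniformlyOn_iff_tendstoLocallyUniformlyOn] at hprod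
  have hid : TendstoLocallyUniformlyOn (fun (_ : Finset ℕ) (z : ℂ) => z) id atTop
      (Metric.ball 0 1) :=
    fun u hu x _ => ⟨Set.univ, univ_mem, .of_forall fun _ _ _ => refl_mem_uniformity hu⟩
  refine ((hid.mul₀ (tendstoLocallyUniformlyOn_pow hprod hcont 24) continuousOn_id
    (hcont.pow 24)).congr fun s z _ => ?_).congr_right fun z hz => ?_
  · simp [discriminantPartialProd, Polynomial.eval_prod, Polynomial.map_prod, Finset.prod_pow]
  · rw [ModularForm.discriminant_cuspFunction_eqOn hz]
    simp [(ModularForm.multipliable_one_sub_pow (by simpa using hz)).tprod_pow]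

theorem qExpansion_discriminant :
    UpperHalfPlane.qExpansion 1 ModularForm.discriminant =
      ramanujanSeries.map (Int.castRingHom ℂ) := by
  ext n
  have hderiv : iteratedDeriv n (UpperHalfPlane.cuspFunction 1 ModularForm.discriminant) 0 =
      n.factorial * ramanujanTau n := by
    refine iteratedDeriv_zero_of_eventually_coeff_eq Metric.isOpen_ball
      (Metric.mem_ball_self one_pos) tendstoLocallyUniformlyOn_discriminantPartialProd ?_
    filter_upwards [eventually_coeff_discriminantPartialProd n] with s hs
    rw [Polynomial.coeff_map, hs, eq_intCast]
  rw [UpperHalfPlane.qExpansion_coeff, hderiv, coeff_map, ramanujanTau, eq_intCast]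
  field_simp [Nat.factorial_ne_zero]

end DiscriminantQExpansion

section Parity

open PowerSeries ModularForm
open scoped ArithmeticFunction.sigma MatrixGroups

/-- The generating series `∑ σ_k(n) q ^ n`, the nonconstant part of an Eisenstein series of weight
`k + 1` up to normalization. -/
noncomputable def sigmaSeries (k : ℕ) : ℤ⟦X⟧ := mk fun n => (σ k n : ℤ)

theorem qExpansion_E₄ :
    UpperHalfPlane.qExpansion 1 E₄ = (1 + 240 • sigmaSeries 3).map (Int.castRingHom ℂ) := by
  ext n
  have hbernoulli : bernoulli 4 = -1 / 30 := by
    rw [bernoulli_eq_bernoulli'_of_ne_one (by decide), bernoulli'_four]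
  rw [EisensteinSeries.E_qExpansion_coeff _ ⟨2, rfl⟩, hbernoulli, coeff_map, map_add, map_nsmul]
  by_cases hn : n = 0
  · simp [hn, sigmaSeries]
  · simp [hn, coeff_one, sigmaSeries]
    ring

theorem qExpansion_E₆ :
    UpperHalfPlane.qExpansion 1 E₆ = (1 - 504 • sigmaSeries 5).map (Int.castRingHom ℂ) := by
  ext n
  have hbernoulli : bernoulli 6 = 1 / 42 := by
    rw [bernoulli_eq_bernoulli'_of_ne_one (by decide)]
    decide +kernel
  rw [EisensteinSeries.E_qExpansion_coeff _ ⟨3, rfl⟩, hbernoulli, coeff_map, map_sub, map_nsmul]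
  by_cases hn : n = 0
  · simp [hn, sigmaSeries]
  · simp [hn, coeff_one, sigmaSeries]
    ring

theorem smul_discriminant_eq_E₄_cube_sub_E₆_sq :
    (1728 : ℂ) • discriminant = E₄.pow 3 - E₆.pow 2 := by
  ext z
  simp only [Pi.smul_apply, discriminant_eq_E₄_cube_sub_E₆_sq, ModularForm.coe_pow, Pi.sub_apply,
    Pi.pow_apply, smul_eq_mul]
  ring

theorem smul_ramanujanSeries_eq_cube_sub_sq :
    1728 • ramanujanSeries = (1 + 240 • sigmaSeries 3) ^ 3 - (1 - 504 • sigmaSeries 5) ^ 2 := by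
  apply PowerSeries.map_injective (Int.castRingHom ℂ) Int.cast_injective
  calc (1728 • ramanujanSeries).map (Int.castRingHom ℂ)
      = (1728 : ℂ) • UpperHalfPlane.qExpansion 1 discriminant := by
        rw [qExpansion_discriminant, map_nsmul, ← Nat.cast_smul_eq_nsmul ℂ, Nat.cast_ofNat]
    _ = UpperHalfPlane.qExpansion 1 ((1728 : ℂ) • discriminant) :=
        (ModularForm.qExpansion_smul one_pos one_mem_strictPeriods_SL 1728
          CuspForm.discriminant).symm
    _ = UpperHalfPlane.qExpansion 1 E₄ ^ 3 - UpperHalfPlane.qExpansion 1 E₆ ^ 2 := by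
        rw [smul_discriminant_eq_E₄_cube_sub_E₆_sq,
          ModularForm.qExpansion_sub one_pos one_mem_strictPeriods_SL,
          ModularForm.qExpansion_pow one_pos one_mem_strictPeriods_SL,
          ModularForm.qExpansion_pow one_pos one_mem_strictPeriods_SL]
    _ = _ := by rw [qExpansion_E₄, qExpansion_E₆, ← map_pow, ← map_pow, ← map_sub]

theorem twelve_mul_ramanujanTau (n : ℕ) :
    12 * ramanujanTau n = 5 * σ 3 n + 7 * σ 5 n + 1200 * coeff n (sigmaSeries 3 ^ 2) +
      96000 * coeff n (sigmaSeries 3 ^ 3) - 1764 * coeff n (sigmaSeries 5 ^ 2) := by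
  have hexpand : 1728 • ramanujanSeries = 720 • sigmaSeries 3 + 172800 • sigmaSeries 3 ^ 2 +
      13824000 • sigmaSeries 3 ^ 3 + 1008 • sigmaSeries 5 - 254016 • sigmaSeries 5 ^ 2 := by
    rw [smul_ramanujanSeries_eq_cube_sub_sq]
    simp only [nsmul_eq_mul]
    push_cast
    ring
  have hcoeff (k : ℕ) : coeff n (sigmaSeries k) = σ k n := coeff_mk n _
  have hn := congrArg (coeff n) hexpand
  simp only [map_add, map_sub, map_nsmul, hcoeff] at hn
  simp only [nsmul_eq_mul, Nat.cast_ofNat] at hn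
  rw [ramanujanTau]
  linarith

theorem even_coeff_sq_of_odd (f : ℤ⟦X⟧) {n : ℕ} (hn : Odd n) : Even (coeff n (f ^ 2)) := by
  rw [← ZMod.intCast_eq_zero_iff_even, sq, coeff_mul, Int.cast_sum]
  refine Finset.sum_involution (fun x _ => x.swap) ?_ ?_ ?_ fun x _ => x.swap_swap
  · intro x _
    rw [Prod.fst_swap, Prod.snd_swap, mul_comm, CharTwo.add_self_eq_zero]
  · intro x hx _ hswap
    have hsum := Finset.HasAntidiagonal.mem_antidiagonal.mp hx
    have heq : x.2 = x.1 := congrArg Prod.fst hswap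
    grind
  · intro x hx
    simpa [add_comm] using hx

open scoped PowerSeries.WithPiTopology in
theorem ramanujanSeries_eq_X_mul_sq :
    ramanujanSeries = X * ((∏' n : ℕ, (1 - (X : ℤ⟦X⟧) ^ (n + 1))) ^ 12) ^ 2 := by
  rw [ramanujanSeries, ← pow_mul, (WithPiTopology.multipliable_one_sub_X_pow ℤ).tprod_pow]

theorem even_ramanujanTau_of_even {n : ℕ} (hn : Even n) : Even (ramanujanTau n) := by
  rw [ramanujanTau, ramanujanSeries_eq_X_mul_sq]
  cases n with
  | zero => simp
  | succ m =>
    rw [coeff_succ_X_mul]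
    exact even_coeff_sq_of_odd _ (by grind)

theorem five_mul_cube_add_seven_mul_pow_five_modEq {d : ℤ} (hd : Odd d) :
    5 * d ^ 3 + 7 * d ^ 5 ≡ 12 [ZMOD 24] := by
  have hzmod : ∀ x : ZMod 24, 5 * (2 * x + 1) ^ 3 + 7 * (2 * x + 1) ^ 5 = 12 := by decide
  obtain ⟨r, rfl⟩ := hd
  rw [← Nat.cast_ofNat (n := 24), ← ZMod.intCast_eq_intCast_iff]
  exact_mod_cast hzmod r

theorem ramanujanTau_modEq_card_divisors_of_odd {n : ℕ} (hn : Odd n) :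
    ramanujanTau n ≡ n.divisors.card [ZMOD 2] := by
  have hσ : (5 * σ 3 n + 7 * σ 5 n : ℤ) ≡ 12 * n.divisors.card [ZMOD 24] :=
    calc (5 * σ 3 n + 7 * σ 5 n : ℤ) = ∑ d ∈ n.divisors, (5 * (d : ℤ) ^ 3 + 7 * (d : ℤ) ^ 5) := by
          simp [ArithmeticFunction.sigma_apply, Finset.mul_sum, Finset.sum_add_distrib]
      _ ≡ ∑ _d ∈ n.divisors, 12 [ZMOD 24] := Int.ModEq.sum fun _ hd =>
          five_mul_cube_add_seven_mul_pow_five_modEq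
            (hn.of_dvd_nat (Nat.dvd_of_mem_divisors hd)).natCast
      _ = 12 * n.divisors.card := by rw [Finset.sum_const, nsmul_eq_mul, mul_comm]
  obtain ⟨c, hc⟩ := even_coeff_sq_of_odd (sigmaSeries 5) hn
  refine Int.ModEq.mul_left_cancel' (c := 12) (by decide) (.trans ?_ hσ)
  rw [twelve_mul_ramanujanTau, hc, Int.modEq_comm, Int.modEq_iff_dvd]
  exact ⟨50 * coeff n (sigmaSeries 3 ^ 2) + 4000 * coeff n (sigmaSeries 3 ^ 3) - 147 * c, by ring⟩

theorem even_ramanujanTau_of_prime {l : ℕ} (hl : l.Prime) : Even (ramanujanTau l) := by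
  rcases l.even_or_odd with heven | hodd
  · exact even_ramanujanTau_of_even heven
  · have hmod := ramanujanTau_modEq_card_divisors_of_odd hodd
    rw [hl.divisors, Finset.card_pair hl.one_lt.ne] at hmod
    exact Int.even_iff.mpr hmod

end Parity

section HeckeOperator

open UpperHalfPlane ModularForm
open scoped MatrixGroups ModularForm

/-- The matrix `(a b; 0 d)` as an element of `GL(2, ℝ)`. -/
noncomputable def upperTriangularGL (a b d : ℝ) (ha : a ≠ 0) (hd : d ≠ 0) : GL (Fin 2) ℝ :=
  .mkOfDetNeZero !![a, b; 0, d] (by simp [ha, hd])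

section UpperTriangular

variable {a b d : ℝ} (ha : a ≠ 0) (hd : d ≠ 0)

theorem val_upperTriangularGL : (upperTriangularGL a b d ha hd).val = !![a, b; 0, d] := rfl

theorem det_upperTriangularGL : (upperTriangularGL a b d ha hd).det.val = a * d := by
  simp [upperTriangularGL]

theorem coe_upperTriangularGL_smul (had : 0 < a * d) (z : ℍ) :
    ((upperTriangularGL a b d ha hd • z : ℍ) : ℂ) = (a * z + b) / d := by
  rw [coe_smul_of_det_pos (by rwa [det_upperTriangularGL])]
  simp [num, denom, upperTriangularGL]

theorem slash_upperTriangularGL_apply (had : 0 < a * d) (k : ℤ) (f : ℍ → ℂ) (z : ℍ) :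
    (f ∣[k] upperTriangularGL a b d ha hd) z =
      f (upperTriangularGL a b d ha hd • z) * (a * d) ^ (k - 1) * (d : ℂ) ^ (-k) := by
  rw [slash_apply, det_upperTriangularGL, abs_of_pos had, σ,
    if_pos (by rwa [det_upperTriangularGL])]
  simp [denom, upperTriangularGL]

theorem isZeroAtImInfty_slash_upperTriangularGL {f : ℍ → ℂ} (hf : IsZeroAtImInfty f) (k : ℤ) :
    IsZeroAtImInfty (f ∣[k] upperTriangularGL a b d ha hd) :=
  hf.slash k (by simp [upperTriangularGL])

end UpperTriangular

variable (l : ℕ) [NeZero l]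

/-- The matrix `(1 j; 0 l)`. Together with `heckeMatrixInfty` these represent, for prime `l` and `j`
running through the residues modulo `l`, the cosets of `SL(2, ℤ)` in the integral matrices of
determinant `l`. -/
noncomputable def heckeMatrix (j : ℤ) : GL (Fin 2) ℝ :=
  upperTriangularGL 1 j l one_ne_zero (NeZero.ne _)

/-- The matrix `(l 0; 0 1)`, representing the coset that contains no `heckeMatrix`. -/
noncomputable def heckeMatrixInfty : GL (Fin 2) ℝ :=
  upperTriangularGL l 0 1 (NeZero.ne _) one_ne_zero

/-- The Hecke operator `T_l` of weight `k` for prime `l`, on functions on the upper half plane. The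
factor `l ^ (k - 1)` of the usual normalization is part of Mathlib's slash action. -/
noncomputable def heckeSum (k : ℤ) (f : ℍ → ℂ) : ℍ → ℂ :=
  f ∣[k] heckeMatrixInfty l + ∑ j : ZMod l, f ∣[k] heckeMatrix l j.cast

variable {l} {k : ℤ} {f : ℍ → ℂ}

theorem slash_slash_of_mul_eq (hf : ∀ γ : SL(2, ℤ), f ∣[k] γ = f) (γ δ : SL(2, ℤ))
    {A B : GL (Fin 2) ℝ}
    (h : A.val * δ.val.map (Int.cast : ℤ → ℝ) = γ.val.map (Int.cast : ℤ → ℝ) * B.val) :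
    (f ∣[k] A) ∣[k] δ = f ∣[k] B := by
  have hGL : A * (δ : GL (Fin 2) ℝ) = (γ : GL (Fin 2) ℝ) * B := Units.ext h
  rw [SL_slash, ← SlashAction.slash_mul, hGL, SlashAction.slash_mul, ← SL_slash, hf]

theorem slash_heckeMatrix_congr (hf : ∀ γ : SL(2, ℤ), f ∣[k] γ = f) {i j : ℤ}
    (h : (i : ZMod l) = j) : f ∣[k] heckeMatrix l i = f ∣[k] heckeMatrix l j := by
  obtain ⟨m, hm⟩ := (ZMod.intCast_eq_intCast_iff_dvd_sub j i l).mp h.symm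
  obtain rfl : i = j + l * m := by linarith
  have := slash_slash_of_mul_eq hf ⟨!![1, m; 0, 1], by simp⟩ 1
    (A := heckeMatrix l (j + l * m)) (B := heckeMatrix l j) (by
      ext r s
      fin_cases r <;> fin_cases s <;>
        simp [heckeMatrix, val_upperTriangularGL, Matrix.mul_apply, mul_comm])
  simpa using this

theorem slash_heckeMatrixInfty_slash_T (hf : ∀ γ : SL(2, ℤ), f ∣[k] γ = f) :
    (f ∣[k] heckeMatrixInfty l) ∣[k] ModularGroup.T = f ∣[k] heckeMatrixInfty l := by
  refine slash_slash_of_mul_eq hf ⟨!![1, l; 0, 1], by simp⟩ _ ?_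
  ext r s
  fin_cases r <;> fin_cases s <;>
    simp [heckeMatrixInfty, val_upperTriangularGL, ModularGroup.coe_T, Matrix.mul_apply]

theorem slash_heckeMatrix_slash_T (hf : ∀ γ : SL(2, ℤ), f ∣[k] γ = f) (j : ℤ) :
    (f ∣[k] heckeMatrix l j) ∣[k] ModularGroup.T = f ∣[k] heckeMatrix l (j + 1) := by
  refine slash_slash_of_mul_eq hf 1 _ ?_
  ext r s
  fin_cases r <;> fin_cases s <;>
    simp [heckeMatrix, val_upperTriangularGL, ModularGroup.coe_T, Matrix.mul_apply, add_comm]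

theorem heckeSum_slash_T (hf : ∀ γ : SL(2, ℤ), f ∣[k] γ = f) :
    (heckeSum l k f) ∣[k] ModularGroup.T = heckeSum l k f := by
  rw [heckeSum, SlashAction.add_slash, SlashAction.sum_slash, slash_heckeMatrixInfty_slash_T hf]
  congr 1
  refine Fintype.sum_equiv (Equiv.addRight 1) _ _ fun j => ?_
  rw [slash_heckeMatrix_slash_T hf]
  exact slash_heckeMatrix_congr hf (by simp)

theorem slash_heckeMatrixInfty_slash_S (hf : ∀ γ : SL(2, ℤ), f ∣[k] γ = f) :
    (f ∣[k] heckeMatrixInfty l) ∣[k] ModularGroup.S = f ∣[k] heckeMatrix l 0 := by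
  refine slash_slash_of_mul_eq hf ModularGroup.S _ ?_
  ext r s
  fin_cases r <;> fin_cases s <;>
    simp [heckeMatrixInfty, heckeMatrix, val_upperTriangularGL, ModularGroup.coe_S,
      Matrix.mul_apply]

theorem slash_heckeMatrix_zero_slash_S (hf : ∀ γ : SL(2, ℤ), f ∣[k] γ = f) :
    (f ∣[k] heckeMatrix l 0) ∣[k] ModularGroup.S = f ∣[k] heckeMatrixInfty l := by
  refine slash_slash_of_mul_eq hf ModularGroup.S _ ?_
  ext r s
  fin_cases r <;> fin_cases s <;>
    simp [heckeMatrixInfty, heckeMatrix, val_upperTriangularGL, ModularGroup.coe_S,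
      Matrix.mul_apply]

theorem slash_heckeMatrix_slash_S (hf : ∀ γ : SL(2, ℤ), f ∣[k] γ = f) {i j : ℤ}
    (hij : (i : ZMod l) * j = -1) :
    (f ∣[k] heckeMatrix l i) ∣[k] ModularGroup.S = f ∣[k] heckeMatrix l j := by
  obtain ⟨b, hb⟩ : (l : ℤ) ∣ -1 - i * j := by
    rw [← ZMod.intCast_eq_intCast_iff_dvd_sub]
    simpa using hij
  have hbR : (-1 : ℝ) - i * j = l * b := by exact_mod_cast hb
  refine slash_slash_of_mul_eq hf ⟨!![i, b; l, -j], by rw [Matrix.det_fin_two_of]; linarith⟩ _ ?_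
  ext r s
  fin_cases r <;> fin_cases s <;>
    simp [heckeMatrix, val_upperTriangularGL, ModularGroup.coe_S, Matrix.mul_apply]
  · linarith
  · ring

theorem heckeSum_slash_S [Fact l.Prime] (hf : ∀ γ : SL(2, ℤ), f ∣[k] γ = f) :
    (heckeSum l k f) ∣[k] ModularGroup.S = heckeSum l k f := by
  have hsplit (g : ZMod l → ℍ → ℂ) : ∑ j, g j = g 0 + ∑ j ∈ Finset.univ.erase 0, g j :=
    (Finset.add_sum_erase _ _ (Finset.mem_univ _)).symm
  rw [heckeSum, hsplit, SlashAction.add_slash, SlashAction.add_slash, SlashAction.sum_slash,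
    ZMod.cast_zero, slash_heckeMatrixInfty_slash_S hf, slash_heckeMatrix_zero_slash_S hf,
    add_left_comm]
  congr 2
  refine Finset.sum_nbij' (fun j => -j⁻¹) (fun j => -j⁻¹) ?_ ?_ ?_ ?_ fun j hj => ?_
  · simp
  · simp
  · simp [inv_neg]
  · simp [inv_neg]
  · exact slash_heckeMatrix_slash_S hf (by simp [Finset.ne_of_mem_erase hj])

theorem heckeSum_slash [Fact l.Prime] (hf : ∀ γ : SL(2, ℤ), f ∣[k] γ = f) (γ : SL(2, ℤ)) :
    (heckeSum l k f) ∣[k] γ = heckeSum l k f :=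
  SlashInvariantForm.slash_action_generators_SL2Z (heckeSum_slash_S hf) (heckeSum_slash_T hf) γ

theorem isZeroAtImInfty_heckeSum (hf : IsZeroAtImInfty f) : IsZeroAtImInfty (heckeSum l k f) :=
  (isZeroAtImInfty_slash_upperTriangularGL _ _ hf k).add
    (Submodule.sum_mem (Filter.zeroAtFilterSubmodule ℂ atImInfty) fun _ _ =>
      isZeroAtImInfty_slash_upperTriangularGL _ _ hf k)

theorem mdifferentiable_heckeSum
    (hf : MDifferentiable (modelWithCornersSelf ℂ ℂ) (modelWithCornersSelf ℂ ℂ) f) :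
    MDifferentiable (modelWithCornersSelf ℂ ℂ) (modelWithCornersSelf ℂ ℂ) (heckeSum l k f) :=
  (hf.slash k _).add (.sum fun _ _ => hf.slash k _)

/-- The Hecke operator `T_l` on level one cusp forms of weight `k`. -/
noncomputable def heckeCuspForm (l : ℕ) [Fact l.Prime] {k : ℤ} (f : CuspForm 𝒮ℒ k) :
    CuspForm 𝒮ℒ k :=
  have hinv : ∀ γ : SL(2, ℤ), (heckeSum l k f) ∣[k] γ = heckeSum l k f :=
    heckeSum_slash fun γ => f.slash_action_eq' _ ⟨γ, rfl⟩
  { toFun := heckeSum l k f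
    slash_action_eq' := by
      rintro _ ⟨γ, rfl⟩
      exact hinv γ
    holo' := mdifferentiable_heckeSum f.holo'
    zero_at_cusps' := fun hc => by
      rw [Subgroup.IsArithmetic.isCusp_iff_isCusp_SL2Z] at hc
      rw [OnePoint.isZeroAt_iff_forall_SL2Z hc]
      intro γ _
      rw [hinv]
      exact isZeroAtImInfty_heckeSum (CuspFormClass.zero_at_infty f) }

end HeckeOperator

section HeckeQExpansion

open UpperHalfPlane ModularForm Function.Periodic
open scoped ModularForm

theorem hasSum_ite_dvd_iff {α : Type*} [AddCommMonoid α] [TopologicalSpace α] {l : ℕ} [NeZero l]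
    {g : ℕ → α} {s : α} :
    HasSum (fun n => if l ∣ n then g n else 0) s ↔ HasSum (fun m => g (l * m)) s := by
  rw [← (mul_right_injective₀ (NeZero.ne l)).hasSum_iff]
  · simp [Function.comp_def]
  · intro n hn
    rw [if_neg]
    rintro ⟨m, rfl⟩
    exact hn ⟨m, rfl⟩

theorem sum_stdAddChar_pow (l n : ℕ) [NeZero l] :
    ∑ j : ZMod l, ZMod.stdAddChar j ^ n = if l ∣ n then (l : ℂ) else 0 := by
  have h := AddChar.sum_mulShift (n : ZMod l) (ZMod.isPrimitive_stdAddChar l)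
  simpa [mul_comm _ (n : ZMod l), ← nsmul_eq_mul, AddChar.map_nsmul_eq_pow,
    ZMod.natCast_eq_zero_iff, ZMod.card] using h

variable {l : ℕ} [NeZero l]

theorem qParam_one_eq_qParam_pow (z : ℂ) : qParam 1 z = qParam l z ^ l := by
  simp only [qParam, ← Complex.exp_nat_mul]
  congr 1
  have hl0 : (l : ℂ) ≠ 0 := NeZero.ne _
  push_cast
  field_simp

theorem qParam_heckeMatrixInfty_smul (z : ℍ) :
    qParam 1 ↑(heckeMatrixInfty l • z) = qParam 1 z ^ l := by
  rw [heckeMatrixInfty, coe_upperTriangularGL_smul _ _ (by simp [NeZero.pos])]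
  simp only [qParam, ← Complex.exp_nat_mul]
  congr 1
  push_cast
  ring

theorem qParam_heckeMatrix_smul (j : ℤ) (z : ℍ) :
    qParam 1 ↑(heckeMatrix l j • z) = ZMod.stdAddChar (j : ZMod l) * qParam l z := by
  rw [heckeMatrix, coe_upperTriangularGL_smul _ _ (by simp [NeZero.pos]), ZMod.stdAddChar_coe]
  simp only [qParam, ← Complex.exp_add]
  congr 1
  push_cast
  field_simp
  ring

theorem slash_heckeMatrixInfty_apply (k : ℤ) (f : ℍ → ℂ) (z : ℍ) :
    (f ∣[k] heckeMatrixInfty l) z = (l : ℂ) ^ (k - 1) * f (heckeMatrixInfty l • z) := by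
  rw [heckeMatrixInfty, slash_upperTriangularGL_apply _ _ (by simp [NeZero.pos])]
  simp [mul_comm]

theorem slash_heckeMatrix_apply (k j : ℤ) (f : ℍ → ℂ) (z : ℍ) :
    (f ∣[k] heckeMatrix l j) z = (l : ℂ)⁻¹ * f (heckeMatrix l j • z) := by
  have hl0 : (l : ℂ) ≠ 0 := NeZero.ne _
  have hpow : (l : ℂ) ^ (k - 1) * (l : ℂ) ^ (-k) = (l : ℂ)⁻¹ := by
    rw [← zpow_add₀ hl0, ← zpow_neg_one, show k - 1 + -k = -1 by ring]
  rw [heckeMatrix, slash_upperTriangularGL_apply _ _ (by simp [NeZero.pos]), mul_assoc, mul_comm,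
    Complex.ofReal_one, one_mul, Complex.ofReal_natCast, hpow]

variable {k : ℤ} {f : ℍ → ℂ} {a : ℕ → ℂ}

theorem hasSum_slash_heckeMatrixInfty
    (hf : ∀ z : ℍ, HasSum (fun m => a m * qParam 1 z ^ m) (f z)) (z : ℍ) :
    HasSum (fun m => (if l ∣ m then (l : ℂ) ^ (k - 1) * a (m / l) else 0) * qParam 1 z ^ m)
      ((f ∣[k] heckeMatrixInfty l) z) := by
  simp only [ite_mul, zero_mul]
  rw [hasSum_ite_dvd_iff, slash_heckeMatrixInfty_apply]
  refine ((hf (heckeMatrixInfty l • z)).mul_left _).congr_fun fun m => ?_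
  rw [qParam_heckeMatrixInfty_smul, Nat.mul_div_cancel_left _ (NeZero.pos l), pow_mul, mul_assoc]

theorem hasSum_sum_slash_heckeMatrix
    (hf : ∀ z : ℍ, HasSum (fun m => a m * qParam 1 z ^ m) (f z)) (z : ℍ) :
    HasSum (fun m => a (l * m) * qParam 1 z ^ m)
      (∑ j : ZMod l, (f ∣[k] heckeMatrix l j.cast) z) := by
  have hl0 : (l : ℂ) ≠ 0 := NeZero.ne _
  have hterm (j : ZMod l) :
      HasSum (fun n => (l : ℂ)⁻¹ * (a n * (ZMod.stdAddChar j * qParam l z) ^ n))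
      ((f ∣[k] heckeMatrix l j.cast) z) := by
    rw [slash_heckeMatrix_apply]
    refine ((hf (heckeMatrix l j.cast • z)).mul_left _).congr_fun fun n => ?_
    rw [qParam_heckeMatrix_smul, ZMod.intCast_zmod_cast]
  have hsum (n : ℕ) : ∑ j : ZMod l, (l : ℂ)⁻¹ * (a n * (ZMod.stdAddChar j * qParam l z) ^ n) =
      if l ∣ n then a n * qParam l z ^ n else 0 := by
    simp only [mul_pow, ← Finset.mul_sum, ← Finset.sum_mul, sum_stdAddChar_pow]
    split_ifs
    · field_simp
    · simp
  have h := hasSum_sum (s := Finset.univ) fun j _ => hterm j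
  simp only [hsum, hasSum_ite_dvd_iff] at h
  simpa only [qParam_one_eq_qParam_pow (l := l) z, ← pow_mul] using h

theorem hasSum_heckeSum
    (hf : ∀ z : ℍ, HasSum (fun m => a m * qParam 1 z ^ m) (f z)) (z : ℍ) :
    HasSum (fun m => (a (l * m) + if l ∣ m then (l : ℂ) ^ (k - 1) * a (m / l) else 0) *
      qParam 1 z ^ m) (heckeSum l k f z) := by
  rw [heckeSum, Pi.add_apply, Finset.sum_apply, add_comm]
  simp only [add_mul]
  exact (hasSum_sum_slash_heckeMatrix hf z).add (hasSum_slash_heckeMatrixInfty hf z)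

end HeckeQExpansion

section RamanujanTauRecursion

open ModularForm

theorem coeff_qExpansion_discriminant (n : ℕ) :
    (UpperHalfPlane.qExpansion 1 discriminant).coeff n = ramanujanTau n := by
  rw [qExpansion_discriminant, PowerSeries.coeff_map, ramanujanTau, eq_intCast]

theorem ramanujanTau_one : ramanujanTau 1 = 1 := by
  rw [← Int.cast_inj (α := ℂ), ← coeff_qExpansion_discriminant, discriminant_qExpansion_coeff_one,
    Int.cast_one]

theorem coeff_qExpansion_heckeCuspForm_discriminant (l : ℕ) [Fact l.Prime] (m : ℕ) :
    (UpperHalfPlane.qExpansion 1 (heckeCuspForm l CuspForm.discriminant)).coeff m =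
      ramanujanTau (l * m) + if l ∣ m then (l : ℂ) ^ 11 * ramanujanTau (m / l) else 0 := by
  have hΔ (z : UpperHalfPlane) := ModularForm.hasSum_qExpansion (f := CuspForm.discriminant)
    (h := 1) one_pos one_mem_strictPeriods_SL z
  simp only [CuspForm.coe_discriminant, coeff_qExpansion_discriminant] at hΔ
  have h := ModularFormClass.qExpansion_coeff_unique one_pos one_mem_strictPeriods_SL
    (f := heckeCuspForm l CuspForm.discriminant) (hasSum_heckeSum (l := l) (k := 12) hΔ) m
  exact h.symm

theorem ramanujanTau_mul_prime {l : ℕ} (hl : l.Prime) (m : ℕ) :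
    ramanujanTau (l * m) + (if l ∣ m then (l : ℤ) ^ 11 * ramanujanTau (m / l) else 0) =
      ramanujanTau l * ramanujanTau m := by
  have : Fact l.Prime := ⟨hl⟩
  obtain ⟨c, hc⟩ := CuspForm.exists_smul_discriminant_of_weight_eq_twelve
    (heckeCuspForm l CuspForm.discriminant)
  have heigen (m : ℕ) : ramanujanTau (l * m) +
      (if l ∣ m then (l : ℂ) ^ 11 * ramanujanTau (m / l) else 0) = c * ramanujanTau m :=
    calc _ = (UpperHalfPlane.qExpansion 1 (c • discriminant)).coeff m := by
          rw [← coeff_qExpansion_heckeCuspForm_discriminant, ← hc]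
          rfl
      _ = (c • UpperHalfPlane.qExpansion 1 discriminant).coeff m := congrArg _
          (ModularForm.qExpansion_smul one_pos one_mem_strictPeriods_SL c CuspForm.discriminant)
      _ = c * ramanujanTau m := by
          rw [map_smul, coeff_qExpansion_discriminant, smul_eq_mul]
  have hc_eq : (ramanujanTau l : ℂ) = c := by
    simpa [hl.ne_one, ramanujanTau_one] using heigen 1
  have hm := heigen m
  rw [← hc_eq] at hm
  exact_mod_cast hm

theorem ramanujanTau_prime_pow_add_two {l : ℕ} (hl : l.Prime) (n : ℕ) :
    ramanujanTau (l ^ (n + 2)) =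
      ramanujanTau l * ramanujanTau (l ^ (n + 1)) - (l : ℤ) ^ 11 * ramanujanTau (l ^ n) := by
  have h := ramanujanTau_mul_prime hl (l ^ (n + 1))
  rw [if_pos (dvd_pow_self l n.succ_ne_zero), pow_succ l n, Nat.mul_div_cancel _ hl.pos,
    ← pow_succ, ← pow_succ'] at h
  linarith

end RamanujanTauRecursion

theorem two_mul_ramanujanTau_prime_pow_prime_modEq {l p : ℕ} [Fact p.Prime] (hl : l.Prime)
    (hp2 : p ≠ 2) :
    2 * ramanujanTau (l ^ p) ≡ (1 + legendreSym p (ramanujanDisc l)) * ramanujanTau l [ZMOD p] :=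
  two_mul_lucas_prime_modEq hp2 (u := fun n => ramanujanTau (l ^ n)) (by simp [ramanujanTau_one])
    (by simp) (ramanujanTau_prime_pow_add_two hl)

theorem modEq_of_mul_left_modEq_of_isCoprime {n a b c : ℤ} (hc : IsCoprime n c)
    (h : c * a ≡ c * b [ZMOD n]) : a ≡ b [ZMOD n] := by
  rw [Int.modEq_iff_dvd] at h ⊢
  rw [← mul_sub] at h
  exact hc.dvd_of_dvd_mul_left h

theorem even_ramanujanDisc_of_prime {l : ℕ} (hl : l.Prime) : Even (ramanujanDisc l) := by
  rw [ramanujanDisc]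
  exact ((even_ramanujanTau_of_prime hl).pow_of_ne_zero two_ne_zero).sub
    (Even.mul_right (by decide) _)

theorem mainTheorem8 (l : ℕ) (hl : l.Prime) (p : ℕ) [Fact p.Prime]
    (hp : IsCoprime (p : ℤ) (ramanujanDisc l)) :
    (legendreSym p (ramanujanDisc l) = 1 →
      ramanujanTau (l ^ p) ≡ ramanujanTau l [ZMOD (p : ℤ)]) ∧
    (legendreSym p (ramanujanDisc l) = -1 →
      ramanujanTau (l ^ p) ≡ 0 [ZMOD (p : ℤ)]) := by
  have hcop : IsCoprime (p : ℤ) 2 :=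
    hp.of_isCoprime_of_dvd_right (even_ramanujanDisc_of_prime hl).two_dvd
  have hp2 : p ≠ 2 := by
    rintro rfl
    exact Int.prime_two.not_isUnit (isCoprime_self.mp hcop)
  have hmod := two_mul_ramanujanTau_prime_pow_prime_modEq hl hp2
  refine ⟨fun h => ?_, fun h => ?_⟩
  · rw [h, one_add_one_eq_two] at hmod
    exact modEq_of_mul_left_modEq_of_isCoprime hcop hmod
  · rw [h, add_neg_cancel, zero_mul, ← mul_zero 2] at hmod
    exact modEq_of_mul_left_modEq_of_isCoprime hcop hmod
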